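/- Consider a stationary Markov decision model with state space $E=\mathbb{R}$. The action space $A$ is a Borel space (a Borel subset of a Polish space) which is a subset of a real vector space $V$ (no relation between the topology of $A$ and $V$ is required). The admissible pairs form a measurable set $D\subseteq\mathbb{R}\times A$ that contains the graph of a measurable map $\mathbb{R}\to A$; put $D(x)=\{a:(x,a)\in D\}$. The disturbances $Z_1,Z_2,\dots$ are independent and identically distributed on a probability space $(\Omega,\mathcal{A},\mathbb{P})$ with values in a measurable space $\mathcal{Z}$; the transition function $T:D\times\mathcal{Z}\to\mathbb{R}$ and the one-stage cost $c:D\times\mathbb{R}\to\mathbb{R}_+$ are measurable; $\beta>0$ is a discount factor. Let $g:\mathbb{R}\to\mathbb{R}$ be increasing (not necessarily strictly) and convex with $g\ge 0$ on $[0,\infty)$, and put $g(\infty)=\lim_{r\to\infty}g(r)$. Let $\widehat E=\mathbb{R}\times[0,\infty)\times(0,\infty)$. A Markov policy $\pi=(d_0,d_1,\dots)$ is a sequence of measurable maps $d_k:\widehat E\to A$ with $d_k(x,s,t)\in D(x)$. Given $\pi$ and an initial state $(X_0,\mathbf{s}_0,\mathbf{t}_0)=(x,s,t)\in\widehat E$,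 define with $a_k=d_k(X_k,\mathbf{s}_k,\mathbf{t}_k)$ $$X_{k+1}=T(X_k,a_k,Z_{k+1}),\qquad \mathbf{s}_{k+1}=\mathbf{s}_k+\mathbf{t}_k\,c(X_k,a_k,X_{k+1}),\qquad \mathbf{t}_{k+1}=\beta\,\mathbf{t}_k .$$ For $n\in\mathbb{N}_0$ let $$J_n(x,s,t)=\inf_\pi\mathbb{E}\Big[g\Big(s+t\sum_{k=0}^{n-1}\beta^k c(X_k,a_k,X_{k+1})\Big)\Big],\qquad J_\infty(x,s,t)=\inf_\pi\mathbb{E}\Big[g\Big(s+t\sum_{k=0}^{\infty}\beta^k c(X_k,a_k,X_{k+1})\Big)\Big],$$ where the infima are over all Markov policies and the values lie in $[0,\infty]$. Assume: 1. The sets $D(x)$ are compact and $x\mapsto D(x)$ is upper semicontinuous (if $x_k\to x$ and $a_k\in D(x_k)$, then $(a_k)$ has an accumulation point in $D(x)$) and decreasing ($D(x)\supseteq D(y)$ for $x\le y$). 2. For every $z\in\mathcal{Z}$, $(x,a)\mapsto T(x,a,z)$ is lower semicontinuous on $D$ and increasing in $x$. 3. For every $z\in\mathcal{Z}$, $(x,a)\mapsto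 c(x,a,T(x,a,z))$ is lower semicontinuous on $D$ and increasing in $x$. 4. $D$ is a convex subset of $\mathbb{R}\times V$, and for every $z\in\mathcal{Z}$ the functions $(x,a)\mapsto T(x,a,z)$ and $(x,a)\mapsto c(x,a,T(x,a,z))$ are convex on $D$. Then for every $t>0$ the functions $(x,s)\mapsto J_n(x,s,t)$, $n\in\mathbb{N}_0$, and $(x,s)\mapsto J_\infty(x,s,t)$ are convex on $\mathbb{R}\times[0,\infty)$, as functions with values in $[0,\infty]$. -/

import Mathlib

open Filter Topology MeasureTheory ProbabilityTheory
open scoped NNReal ENNReal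

/-- A stationary discounted Markov decision model with state space `E`, action space `A`,
disturbance space `𝒵` and underlying probability space `(Ω, P)`. The transition function and the
one-stage cost are functions on `D × 𝒵` and `D × E`; they are represented by total functions
whose values for `(x, a) ∉ D` carry no assumption and play no role. The disturbance that drives
the transition from time `n` to time `n + 1` is `Z n`. -/
structure StationaryMDP (E A 𝒵 : Type*) {Ω : Type*} [MeasurableSpace E] [MeasurableSpace A]
    [MeasurableSpace 𝒵] [MeasurableSpace Ω] (P : Measure Ω) where
  /-- admissible state-action combinations -/
  D : Set (E × A)
  measurableSet_D : MeasurableSet D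
  exists_graph_subset : ∃ f : E → A, Measurable f ∧ ∀ x, (x, f x) ∈ D
  /-- transition function -/
  T : E → A → 𝒵 → E
  measurable_T : Measurable fun p : D × 𝒵 => T p.1.1.1 p.1.1.2 p.2
  /-- one-stage cost `c x a x'` -/
  c : E → A → E → ℝ≥0
  measurable_c : Measurable fun p : D × E => c p.1.1.1 p.1.1.2 p.2
  /-- discount factor -/
  β : ℝ≥0
  β_pos : 0 < β
  /-- disturbances -/
  Z : ℕ → Ω → 𝒵
  measurable_Z : ∀ n, Measurable (Z n)
  indep_Z : iIndepFun Z P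
  identDistrib_Z : ∀ n, IdentDistrib (Z n) (Z 0) P P

/-- The extended state space `E × [0, ∞) × (0, ∞)` with generic element `(x, s, t)`. -/
abbrev ExtState (E : Type*) : Type _ := E × ℝ≥0 × Set.Ioi (0 : ℝ≥0)

namespace StationaryMDP

variable {E A 𝒵 Ω : Type*} [MeasurableSpace E] [MeasurableSpace A] [MeasurableSpace 𝒵]
  [MeasurableSpace Ω] {P : Measure Ω}

/-- A Markov policy of the extended model: a sequence `d 0, d 1, …` of measurable maps from the
extended state space to `A` that select admissible actions. -/
structure MarkovPolicy (M : StationaryMDP E A 𝒵 P) where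
  d : ℕ → ExtState E → A
  measurable_d : ∀ n, Measurable (d n)
  admissible : ∀ n y, (y.1, d n y) ∈ M.D

/-- The transition function of the extended model,
`(x, s, t, a, z) ↦ (T(x,a,z), s + t c(x,a,T(x,a,z)), β t)`. -/
def extT (M : StationaryMDP E A 𝒵 P) (y : ExtState E) (a : A) (z : 𝒵) : ExtState E :=
  (M.T y.1 a z, y.2.1 + (y.2.2 : ℝ≥0) * M.c y.1 a (M.T y.1 a z),
    ⟨M.β * y.2.2, mul_pos M.β_pos y.2.2.2⟩)

/-- The extended decision process under the policy `π`, started in `y`. -/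
def process (M : StationaryMDP E A 𝒵 P) (π : M.MarkovPolicy) (y : ExtState E) :
    ℕ → Ω → ExtState E
  | 0, _ => y
  | n + 1, ω => M.extT (M.process π y n ω) (π.d n (M.process π y n ω)) (M.Z n ω)

/-- The (undiscounted) cost of stage `k`: `c(X_k, d_k(X_k, s_k, t_k), X_{k+1})`. -/
def stageCost (M : StationaryMDP E A 𝒵 P) (π : M.MarkovPolicy) (y : ExtState E)
    (k : ℕ) (ω : Ω) : ℝ≥0 :=
  M.c (M.process π y k ω).1 (π.d k (M.process π y k ω)) (M.process π y (k + 1) ω).1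

/-- The value `J_{N π}(x, s, t)` of a policy for the planning horizon `N`. -/
noncomputable def policyValue (M : StationaryMDP E A 𝒵 P) (g : ℝ → ℝ) (N : ℕ)
    (π : M.MarkovPolicy) (y : ExtState E) : ℝ≥0∞ :=
  ∫⁻ ω, ENNReal.ofReal (g ((y.2.1 + (y.2.2 : ℝ≥0) *
    ∑ k ∈ Finset.range N, M.β ^ k * M.stageCost π y k ω : ℝ≥0) : ℝ)) ∂P

/-- The value function `J_N` for the planning horizon `N`. -/
noncomputable def value (M : StationaryMDP E A 𝒵 P) (g : ℝ → ℝ) (N : ℕ) (y : ExtState E) :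
    ℝ≥0∞ :=
  ⨅ π : M.MarkovPolicy, M.policyValue g N π y

/-- The increasing function `g`, nonnegative on `[0, ∞)`, as a function on `[0, ∞]`, with
`g(∞) = lim_{r → ∞} g(r) = sup_r g(r)`. -/
noncomputable def extendTop (g : ℝ → ℝ) (u : ℝ≥0∞) : ℝ≥0∞ :=
  if u = ⊤ then ⨆ r : ℝ≥0, ENNReal.ofReal (g r) else ENNReal.ofReal (g u.toReal)

/-- The value `J_{∞ π}(x, s, t)` of a policy for the infinite planning horizon. -/
noncomputable def policyValueInfty (M : StationaryMDP E A 𝒵 P) (g : ℝ → ℝ)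
    (π : M.MarkovPolicy) (y : ExtState E) : ℝ≥0∞ :=
  ∫⁻ ω, extendTop g ((y.2.1 : ℝ≥0∞) + ((y.2.2 : ℝ≥0) : ℝ≥0∞) *
    ∑' k : ℕ, ((M.β ^ k * M.stageCost π y k ω : ℝ≥0) : ℝ≥0∞)) ∂P

/-- The infinite horizon value function `J_∞`. -/
noncomputable def valueInfty (M : StationaryMDP E A 𝒵 P) (g : ℝ → ℝ) (y : ExtState E) :
    ℝ≥0∞ :=
  ⨅ π : M.MarkovPolicy, M.policyValueInfty g π y

/-- The continuity, compactness and monotonicity assumptions on a model with state space `ℝ`. -/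
structure IsMonotoneModel [TopologicalSpace A] (M : StationaryMDP ℝ A 𝒵 P) : Prop where
  isCompact_D : ∀ x, IsCompact {a | (x, a) ∈ M.D}
  upperSemicontinuous_D : ∀ (x : ℕ → ℝ) (x₀ : ℝ) (a : ℕ → A), Tendsto x atTop (𝓝 x₀) →
    (∀ k, (x k, a k) ∈ M.D) → ∃ a₀, (x₀, a₀) ∈ M.D ∧ MapClusterPt a₀ atTop a
  antitone_D : ∀ x y, x ≤ y → {a | (y, a) ∈ M.D} ⊆ {a | (x, a) ∈ M.D}
  lowerSemicontinuous_T : ∀ z, LowerSemicontinuousOn (fun p : ℝ × A => M.T p.1 p.2 z) M.D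
  monotone_T : ∀ x y a z, x ≤ y → (x, a) ∈ M.D → (y, a) ∈ M.D → M.T x a z ≤ M.T y a z
  lowerSemicontinuous_c : ∀ z,
    LowerSemicontinuousOn (fun p : ℝ × A => M.c p.1 p.2 (M.T p.1 p.2 z)) M.D
  monotone_c : ∀ x y a z, x ≤ y → (x, a) ∈ M.D → (y, a) ∈ M.D →
    M.c x a (M.T x a z) ≤ M.c y a (M.T y a z)

end StationaryMDP

section Convexity

variable {V : Type*} [AddCommGroup V] [Module ℝ V] {A : Set V}

/-- A set of pairs `(x, a)` with `a` in the subset `A` of the real vector space `V` is convex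
as a subset of `ℝ × V`. -/
def ConvexPairs (D : Set (ℝ × A)) : Prop :=
  Convex ℝ ((fun p : ℝ × A => (p.1, (p.2 : V))) '' D)

/-- A real function of `(x, a)` satisfies the convexity inequality on `D ⊆ ℝ × A`, whenever a
point `r` of `D` is, in `ℝ × V`, a convex combination of the points `p` and `q` of `D`. -/
def ConvexFunOnPairs (D : Set (ℝ × A)) (f : ℝ × A → ℝ) : Prop :=
  ∀ p ∈ D, ∀ q ∈ D, ∀ r ∈ D, ∀ a b : ℝ, 0 ≤ a → 0 ≤ b → a + b = 1 →
    r.1 = a * p.1 + b * q.1 → (r.2 : V) = a • (p.2 : V) + b • (q.2 : V) →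
      f r ≤ a * f p + b * f q

end Convexity

/-! The proof is dynamic programming. The discount component evolves deterministically, so it
becomes a parameter `t`, and the operator `bellman` acts on functions `U` of `(x, s)` with values in
`[0, ∞]`.

This operator preserves three properties together. Monotonicity survives because `D` is decreasing.
Lower semicontinuity survives by Fatou and compactness, which also yield measurable minimizers
(`exists_measurable_minimizer`). Convexity survives (`convexOn_bellman`) because combining two
minimizers gives an admissible action whose successor lies below the combined successors;
monotonicity and convexity of `U` finish the step.

Measurable minimizers form an optimal policy, so finite-horizon values are iterates of the operator
(`value_eq_backwardValue`). Since costs are nonnegative, the iterates increase with the horizon, and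
compactness lets the operator pass to their supremum. Hence `J_∞` is that supremum
(`valueInfty_eq_iSup`), and suprema of convex functions are convex. -/

theorem lowerSemicontinuous_lintegral {X α : Type*} [TopologicalSpace X]
    [FirstCountableTopology X] [MeasurableSpace α] {μ : Measure α} {f : X → α → ℝ≥0∞}
    (hmeas : ∀ x, Measurable (f x)) (hlsc : ∀ a, LowerSemicontinuous fun x => f x a) :
    LowerSemicontinuous fun x => ∫⁻ a, f x a ∂μ := by
  rw [lowerSemicontinuous_iff_le_liminf]
  intro x
  refine le_trans (lintegral_mono fun a => ?_) (lintegral_liminf_le hmeas)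
  exact (lowerSemicontinuous_iff_le_liminf.1 (hlsc a)) x

/-! ### Measurable selection of minimizers. -/

section Selection

variable {X A : Type*}

/-- If a set-valued map with compact values admits a measurable hitting set for every closed set,
then so does the map of minimizers of a function with measurable sublevel hitting sets. -/
theorem measurableSet_argmin_inter_nonempty [MeasurableSpace X] [TopologicalSpace A]
    {Φ : X → Set A} {v : X → A → ℝ≥0∞} (hΦ : ∀ x, IsCompact (Φ x))
    (hv : ∀ x, LowerSemicontinuousOn (v x) (Φ x))
    (hm : ∀ F, IsClosed F → MeasurableSet {x | (Φ x ∩ F).Nonempty})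
    (hmv : ∀ F, IsClosed F → ∀ r, MeasurableSet {x | ∃ a ∈ Φ x ∩ F, v x a ≤ r})
    {F : Set A} (hF : IsClosed F) :
    MeasurableSet {x | ({a ∈ Φ x | ∀ b ∈ Φ x, v x a ≤ v x b} ∩ F).Nonempty} := by
  obtain ⟨S, hSc, hSd⟩ := TopologicalSpace.exists_countable_dense ℝ≥0∞
  -- A minimizer lies in `F` iff no `q` from a countable dense set separates the minimum over `Φ x`
  -- from the minimum over `Φ x ∩ F`.
  have key : {x | ({a ∈ Φ x | ∀ b ∈ Φ x, v x a ≤ v x b} ∩ F).Nonempty} =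
      {x | (Φ x ∩ F).Nonempty} ∩ ⋂ q ∈ S,
        ({x | ∃ b ∈ Φ x ∩ Set.univ, v x b ≤ q}ᶜ ∪ {x | ∃ a ∈ Φ x ∩ F, v x a ≤ q}) := by
    ext x
    simp only [Set.mem_ofPred_eq, Set.mem_inter_iff, Set.mem_iInter, Set.mem_union,
      Set.mem_compl_iff, Set.inter_univ]
    constructor
    · rintro ⟨a, ⟨ha, hmin⟩, haF⟩
      refine ⟨⟨a, ha, haF⟩, fun q _ => ?_⟩
      by_cases h : ∃ b ∈ Φ x, v x b ≤ q
      · obtain ⟨b, hb, hbq⟩ := h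
        exact Or.inr ⟨a, ⟨ha, haF⟩, (hmin b hb).trans hbq⟩
      · exact Or.inl h
    · rintro ⟨hne, hq⟩
      obtain ⟨a, ha, hmin⟩ := LowerSemicontinuousOn.exists_isMinOn hne ((hΦ x).inter_right hF)
        ((hv x).mono Set.inter_subset_left)
      refine ⟨a, ⟨ha.1, fun b hb => ?_⟩, ha.2⟩
      by_contra! hlt
      obtain ⟨q, hqS, hbq, hqa⟩ := hSd.exists_between hlt
      rcases hq q hqS with h | ⟨a', ha', hle⟩
      · exact h ⟨b, hb, hbq.le⟩
      · exact absurd ((hmin ha').trans hle) (not_le.2 hqa)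
  rw [key]
  exact (hm F hF).inter (MeasurableSet.biInter hSc fun q _ =>
    ((hmv _ isClosed_univ q).compl.union (hmv F hF q)))

/-- The minimizers are the sublevel set at the minimum value. -/
theorem LowerSemicontinuousOn.isCompact_argmin [TopologicalSpace A] {K : Set A} {w : A → ℝ≥0∞}
    (hK : IsCompact K) (hw : LowerSemicontinuousOn w K) :
    IsCompact {a ∈ K | ∀ b ∈ K, w a ≤ w b} := by
  rcases K.eq_empty_or_nonempty with rfl | hne
  · simp
  obtain ⟨a, ha, hmin⟩ := hw.exists_isMinOn hne hK
  have : {a ∈ K | ∀ b ∈ K, w a ≤ w b} = K ∩ w ⁻¹' Set.Iic (w a) := by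
    ext b
    exact ⟨fun h => ⟨h.1, h.2 a ha⟩, fun h => ⟨h.1, fun c hc => h.2.trans (hmin hc)⟩⟩
  rw [this]
  exact hw.isCompact_inter_preimage_Iic hK _

/-- Successive minimization over `Φ x` of the distances to the points of a sequence. -/
def lexArgmin [EDist A] (Φ : X → Set A) (u : ℕ → A) : ℕ → X → Set A
  | 0, x => Φ x
  | n + 1, x => {a ∈ lexArgmin Φ u n x | ∀ b ∈ lexArgmin Φ u n x, edist a (u n) ≤ edist b (u n)}

/-- A compact-valued map with measurable hitting sets of closed sets has a measurable selector. -/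
theorem exists_measurable_selector [MeasurableSpace X] [TopologicalSpace A]
    [TopologicalSpace.MetrizableSpace A] [SecondCountableTopology A] [Nonempty A]
    [MeasurableSpace A] [BorelSpace A]
    {Φ : X → Set A} (hΦ : ∀ x, IsCompact (Φ x)) (hne : ∀ x, (Φ x).Nonempty)
    (hm : ∀ F, IsClosed F → MeasurableSet {x | (Φ x ∩ F).Nonempty}) :
    ∃ f : X → A, Measurable f ∧ ∀ x, f x ∈ Φ x := by
  let _ : MetricSpace A := TopologicalSpace.metrizableSpaceMetric A
  set u := TopologicalSpace.denseSeq A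
  have hcont : ∀ n, Continuous fun a : A => edist a (u n) := fun n =>
    continuous_id.edist continuous_const
  have hlsc : ∀ n (K : Set A), LowerSemicontinuousOn (fun a : A => edist a (u n)) K := fun n K =>
    ((hcont n).lowerSemicontinuous).lowerSemicontinuousOn K
  have hcomp : ∀ n x, IsCompact (lexArgmin Φ u n x) := by
    intro n x
    induction n with
    | zero => exact hΦ x
    | succ n ih => exact (hlsc n _).isCompact_argmin ih
  have hnon : ∀ n x, (lexArgmin Φ u n x).Nonempty := by
    intro n x
    induction n with
    | zero => exact hne x
    | succ n ih =>
      obtain ⟨a, ha, hmin⟩ := (hlsc n _).exists_isMinOn ih (hcomp n x)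
      exact ⟨a, ha, fun b hb => hmin hb⟩
  have hmeas : ∀ n F, IsClosed F → MeasurableSet {x | (lexArgmin Φ u n x ∩ F).Nonempty} := by
    intro n
    induction n with
    | zero => exact hm
    | succ n ih =>
      intro F hF
      refine measurableSet_argmin_inter_nonempty (Φ := lexArgmin Φ u n)
        (v := fun _ a => edist a (u n)) (hcomp n) (fun x => hlsc n _) ih (fun F hF r => ?_) hF
      -- The distance bound only replaces `F` by its intersection with a closed ball, so the
      -- induction hypothesis applies again.
      convert! ih (F ∩ (fun a => edist a (u n)) ⁻¹' Set.Iic r)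
        (hF.inter (isClosed_Iic.preimage (hcont n))) using 1
      ext x
      simp only [Set.Nonempty, Set.mem_ofPred_eq, Set.mem_inter_iff, Set.mem_preimage,
        Set.mem_Iic, and_assoc]
  have hsub : ∀ n x, lexArgmin Φ u (n + 1) x ⊆ lexArgmin Φ u n x := fun n x a ha => ha.1
  have hinter : ∀ x F, IsClosed F → (∀ n, (lexArgmin Φ u n x ∩ F).Nonempty) →
      ∃ a, (∀ n, a ∈ lexArgmin Φ u n x) ∧ a ∈ F := by
    intro x F hF h
    obtain ⟨a, ha⟩ := IsCompact.nonempty_iInter_of_sequence_nonempty_isCompact_isClosed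
      (fun n => lexArgmin Φ u n x ∩ F) (fun n => Set.inter_subset_inter_left _ (hsub n x)) h
      ((hcomp 0 x).inter_right hF) (fun n => (hcomp n x).isClosed.inter hF)
    rw [Set.mem_iInter] at ha
    exact ⟨a, fun n => (ha n).1, (ha 0).2⟩
  -- Two points surviving every stage have equal distances to a dense sequence, hence coincide.
  have huniq : ∀ x a b, (∀ n, a ∈ lexArgmin Φ u n x) → (∀ n, b ∈ lexArgmin Φ u n x) → a = b := by
    intro x a b ha hb
    have hd : ∀ n, edist a (u n) = edist b (u n) := fun n =>
      le_antisymm ((ha (n + 1)).2 b (hb n)) ((hb (n + 1)).2 a (ha n))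
    have hab : (fun z : A => edist a z) = fun z => edist b z := by
      refine (continuous_const.edist continuous_id).ext_on
        (TopologicalSpace.denseRange_denseSeq A) (continuous_const.edist continuous_id) ?_
      rintro _ ⟨n, rfl⟩
      exact hd n
    have := congrFun hab b
    simpa using this
  choose f hf _ using fun x => hinter x Set.univ isClosed_univ fun n => by simpa using hnon n x
  refine ⟨f, measurable_of_isClosed fun F hF => ?_, fun x => hf x 0⟩
  -- If every stage meets `F`, compactness gives a point of `F` surviving all stages, and that point
  -- is `f x`.
  have : f ⁻¹' F = ⋂ n, {x | (lexArgmin Φ u n x ∩ F).Nonempty} := by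
    ext x
    simp only [Set.mem_preimage, Set.mem_iInter, Set.mem_ofPred_eq]
    refine ⟨fun h n => ⟨f x, hf x n, h⟩, fun h => ?_⟩
    obtain ⟨a, ha, haF⟩ := hinter x F hF h
    rwa [huniq x (f x) a (hf x) ha]
  rw [this]
  exact MeasurableSet.iInter fun n => hmeas n F hF

/-- For an upper semicontinuous set-valued map with graph `G` and a function `v` that is lower
semicontinuous on `G`, the points `x` at which `v x` takes a value at most `r` in a given closed
set form a closed set. -/
theorem isClosed_exists_le [TopologicalSpace X] [SequentialSpace X] [TopologicalSpace A]
    {G : Set (X × A)} {v : X × A → ℝ≥0∞}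
    (husc : ∀ (x : ℕ → X) (x₀ : X) (a : ℕ → A), Tendsto x atTop (𝓝 x₀) →
      (∀ k, (x k, a k) ∈ G) → ∃ a₀, (x₀, a₀) ∈ G ∧ MapClusterPt a₀ atTop a)
    (hv : LowerSemicontinuousOn v G) {F : Set A} (hF : IsClosed F) (r : ℝ≥0∞) :
    IsClosed {x | ∃ a, (x, a) ∈ G ∧ a ∈ F ∧ v (x, a) ≤ r} := by
  rw [← isSeqClosed_iff_isClosed]
  intro x x₀ hx hlim
  choose a haG haF har using hx
  obtain ⟨a₀, ha₀, hcl⟩ := husc x x₀ a hlim haG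
  refine ⟨a₀, ha₀, ?_, ?_⟩
  · by_contra hn
    obtain ⟨k, hk⟩ := (hcl.frequently (hF.isOpen_compl.mem_nhds hn)).exists
    exact hk (haF k)
  · by_contra! hlt
    have h := hv (x₀, a₀) ha₀ r hlt
    rw [eventually_nhdsWithin_iff, nhds_prod_eq] at h
    obtain ⟨p, hp, q, hq, hpq⟩ := eventually_prod_iff.1 h
    -- `x k` is eventually in `p`, while `a k` is only frequently in `q`; one common index suffices.
    obtain ⟨k, hk, hk'⟩ := ((hcl.frequently hq).and_eventually (hlim.eventually hp)).exists
    exact absurd (har k) (not_le.2 (hpq hk' hk (haG k)))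

/-- By `isClosed_exists_le` the constrained hitting sets are closed; the level `⊤` gives the
unconstrained ones. So the argmin map satisfies the selector criterion. -/
theorem exists_measurable_argmin [TopologicalSpace X] [SequentialSpace X] [MeasurableSpace X]
    [OpensMeasurableSpace X] [TopologicalSpace A]
    [TopologicalSpace.MetrizableSpace A] [SecondCountableTopology A]
    [MeasurableSpace A] [BorelSpace A]
    {G : Set (X × A)} {v : X × A → ℝ≥0∞} (hcomp : ∀ x, IsCompact {a | (x, a) ∈ G})
    (hne : ∀ x, ∃ a, (x, a) ∈ G)
    (husc : ∀ (x : ℕ → X) (x₀ : X) (a : ℕ → A), Tendsto x atTop (𝓝 x₀) →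
      (∀ k, (x k, a k) ∈ G) → ∃ a₀, (x₀, a₀) ∈ G ∧ MapClusterPt a₀ atTop a)
    (hv : LowerSemicontinuousOn v G) :
    ∃ f : X → A, Measurable f ∧ ∀ x, (x, f x) ∈ G ∧ ∀ a, (x, a) ∈ G → v (x, f x) ≤ v (x, a) := by
  rcases isEmpty_or_nonempty X with hX | ⟨⟨x₀⟩⟩
  · exact ⟨fun x => isEmptyElim x, measurable_of_empty _, fun x => isEmptyElim x⟩
  have : Nonempty A := ⟨(hne x₀).choose⟩
  have hlsc : ∀ x, LowerSemicontinuousOn (fun a => v (x, a)) {a | (x, a) ∈ G} := fun x =>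
    hv.comp (by fun_prop) fun a ha => ha
  have hmv : ∀ F, IsClosed F → ∀ r,
      MeasurableSet {x | ∃ a ∈ {a | (x, a) ∈ G} ∩ F, v (x, a) ≤ r} := by
    intro F hF r
    convert! (isClosed_exists_le husc hv hF r).measurableSet using 1
    ext x
    simp only [Set.mem_ofPred_eq, Set.mem_inter_iff, and_assoc]
  have hm : ∀ F, IsClosed F → MeasurableSet {x | ({a | (x, a) ∈ G} ∩ F).Nonempty} := by
    intro F hF
    convert! hmv F hF ⊤ using 1
    ext x
    simp [Set.Nonempty]
  obtain ⟨f, hf, hsel⟩ := exists_measurable_selector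
    (Φ := fun x => {a ∈ {a | (x, a) ∈ G} | ∀ b ∈ {a | (x, a) ∈ G}, v (x, a) ≤ v (x, b)})
    (fun x => (hlsc x).isCompact_argmin (hcomp x))
    (fun x => by
      obtain ⟨a, ha, hmin⟩ := (hlsc x).exists_isMinOn (hne x) (hcomp x)
      exact ⟨a, ha, fun b hb => hmin hb⟩)
    (fun F hF => measurableSet_argmin_inter_nonempty (v := fun x a => v (x, a))
      hcomp hlsc hm hmv hF)
  exact ⟨f, hf, hsel⟩

end Selection

/-- Choose `u` strictly below `h x` when possible; otherwise `h x` is the least element, as can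
happen at `0` in `ℝ≥0`, and is itself a lower bound. -/
theorem LowerSemicontinuous.exists_mem_nhds_eventually_le {X α : Type*} [TopologicalSpace X]
    [LinearOrder α] [TopologicalSpace α] [OrderTopology α] [DenselyOrdered α] {h : X → α}
    (hh : LowerSemicontinuous h) (x : X) {p : Set α} (hp : p ∈ 𝓝 (h x)) :
    ∃ u ∈ p, ∀ᶠ x' in 𝓝 x, u ≤ h x' := by
  by_cases hb : ∃ l, l < h x
  · obtain ⟨l, hl, hlp⟩ := exists_Ioc_subset_of_mem_nhds hp hb
    obtain ⟨u, hlu, hux⟩ := exists_between hl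
    exact ⟨u, hlp ⟨hlu, hux.le⟩, (hh x u hux).mono fun _ h => h.le⟩
  · push Not at hb
    exact ⟨h x, mem_of_mem_nhds hp, Eventually.of_forall fun x' => hb _⟩

/-- A monotone lower semicontinuous function of two lower semicontinuous functions is lower
semicontinuous. -/
theorem LowerSemicontinuous.comp_prodMk_of_monotone {X α β γ : Type*} [TopologicalSpace X]
    [LinearOrder α] [TopologicalSpace α] [OrderTopology α] [DenselyOrdered α]
    [LinearOrder β] [TopologicalSpace β] [OrderTopology β] [DenselyOrdered β] [Preorder γ]
    {U : α × β → γ} (hU : LowerSemicontinuous U) (hmono : Monotone U) {h₁ : X → α} {h₂ : X → β}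
    (hh₁ : LowerSemicontinuous h₁) (hh₂ : LowerSemicontinuous h₂) :
    LowerSemicontinuous fun x => U (h₁ x, h₂ x) := by
  intro x y hy
  have h := hU (h₁ x, h₂ x) y hy
  rw [nhds_prod_eq] at h
  obtain ⟨p, hp, q, hq, hpq⟩ := eventually_prod_iff.1 h
  obtain ⟨u, hu, hux⟩ := hh₁.exists_mem_nhds_eventually_le x hp
  obtain ⟨w, hw, hwx⟩ := hh₂.exists_mem_nhds_eventually_le x hq
  filter_upwards [hux, hwx] with x' h₁' h₂'
  exact lt_of_lt_of_le (hpq hu hw) (hmono ⟨h₁', h₂'⟩)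

/-! ### The one-step cost operator and what it preserves. -/

namespace StationaryMDP

variable {E A 𝒵 Ω : Type*} [MeasurableSpace E] [MeasurableSpace A] [MeasurableSpace 𝒵]
  [MeasurableSpace Ω] {P : Measure Ω}

section Measurability

variable {Y : Type*} [MeasurableSpace Y] {x : Y → E} {a : Y → A}

theorem measurable_T_comp (M : StationaryMDP E A 𝒵 P) {z : Y → 𝒵} (hx : Measurable x)
    (ha : Measurable a) (hz : Measurable z) (hD : ∀ y, (x y, a y) ∈ M.D) :
    Measurable fun y => M.T (x y) (a y) (z y) :=
  M.measurable_T.comp (f := fun y => ((⟨(x y, a y), hD y⟩ : M.D), z y))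
    (((hx.prodMk ha).subtype_mk).prodMk hz)

theorem measurable_c_comp (M : StationaryMDP E A 𝒵 P) {x' : Y → E} (hx : Measurable x)
    (ha : Measurable a) (hx' : Measurable x') (hD : ∀ y, (x y, a y) ∈ M.D) :
    Measurable fun y => M.c (x y) (a y) (x' y) :=
  M.measurable_c.comp (f := fun y => ((⟨(x y, a y), hD y⟩ : M.D), x' y))
    (((hx.prodMk ha).subtype_mk).prodMk hx')

end Measurability

/-- The transition of state and accumulated cost at discount level `t`. -/
def costStep (M : StationaryMDP E A 𝒵 P) (t : ℝ≥0) (p : E × ℝ≥0) (a : A) (z : 𝒵) : E × ℝ≥0 :=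
  (M.T p.1 a z, p.2 + t * M.c p.1 a (M.T p.1 a z))

theorem measurable_costStep_comp (M : StationaryMDP E A 𝒵 P) {Y : Type*} [MeasurableSpace Y]
    (t : ℝ≥0) {p : Y → E × ℝ≥0} {a : Y → A} {z : Y → 𝒵} (hp : Measurable p) (ha : Measurable a)
    (hz : Measurable z) (hD : ∀ y, ((p y).1, a y) ∈ M.D) :
    Measurable fun y => M.costStep t (p y) (a y) (z y) := by
  have hT := M.measurable_T_comp hp.fst ha hz hD
  exact hT.prodMk (hp.snd.add ((M.measurable_c_comp hp.fst ha hT hD).const_mul t))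

/-- The expected value of `U` after one step with action `a`. -/
noncomputable def costToGo (M : StationaryMDP E A 𝒵 P) (t : ℝ≥0) (U : E × ℝ≥0 → ℝ≥0∞)
    (p : E × ℝ≥0) (a : A) : ℝ≥0∞ :=
  ∫⁻ z, U (M.costStep t p a z) ∂(P.map (M.Z 0))

/-- The minimal cost operator of the extended model at discount level `t`. -/
noncomputable def bellman (M : StationaryMDP E A 𝒵 P) (t : ℝ≥0) (U : E × ℝ≥0 → ℝ≥0∞)
    (p : E × ℝ≥0) : ℝ≥0∞ :=
  ⨅ a : A, ⨅ _ : (p.1, a) ∈ M.D, M.costToGo t U p a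

theorem bellman_le (M : StationaryMDP E A 𝒵 P) (t : ℝ≥0) (U : E × ℝ≥0 → ℝ≥0∞)
    {p : E × ℝ≥0} {a : A} (ha : (p.1, a) ∈ M.D) : M.bellman t U p ≤ M.costToGo t U p a :=
  iInf₂_le a ha

theorem bellman_mono (M : StationaryMDP E A 𝒵 P) (t : ℝ≥0) {U U' : E × ℝ≥0 → ℝ≥0∞}
    (h : U ≤ U') : M.bellman t U ≤ M.bellman t U' :=
  fun _ => iInf₂_mono fun _ _ => lintegral_mono fun _ => h _

theorem exists_mem_D (M : StationaryMDP E A 𝒵 P) (x : E) : ∃ a, (x, a) ∈ M.D := by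
  obtain ⟨f, -, hf⟩ := M.exists_graph_subset
  exact ⟨f x, hf x⟩

theorem measurable_costStep (M : StationaryMDP E A 𝒵 P) (t : ℝ≥0) {p : E × ℝ≥0} {a : A}
    (ha : (p.1, a) ∈ M.D) : Measurable (M.costStep t p a) :=
  M.measurable_costStep_comp t (p := fun _ => p) (a := fun _ => a) measurable_const
    measurable_const measurable_id fun _ => ha

namespace IsMonotoneModel

variable {A : Type*} [TopologicalSpace A] [MeasurableSpace A]
  {M : StationaryMDP ℝ A 𝒵 P} {U : ℝ × ℝ≥0 → ℝ≥0∞}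

/-- The successor is only lower semicontinuous in state and action; monotonicity of `U` makes the
composition lower semicontinuous, and Fatou handles the integral. -/
theorem lowerSemicontinuousOn_costToGo [TopologicalSpace.MetrizableSpace A]
    (hM : M.IsMonotoneModel) (t : ℝ≥0)
    (hU : LowerSemicontinuous U) (hmono : Monotone U) :
    LowerSemicontinuousOn (fun q : (ℝ × ℝ≥0) × A => M.costToGo t U q.1 q.2)
      {q | (q.1.1, q.2) ∈ M.D} := by
  rw [← lowerSemicontinuous_restrict_iff]
  refine lowerSemicontinuous_lintegral (fun q => hU.measurable.comp (M.measurable_costStep t q.2))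
    fun z => ?_
  have hmaps : Set.MapsTo (fun q : (ℝ × ℝ≥0) × A => (q.1.1, q.2)) {q | (q.1.1, q.2) ∈ M.D} M.D :=
    fun q hq => hq
  refine hU.comp_prodMk_of_monotone hmono ?_ ?_
  · exact lowerSemicontinuous_restrict_iff.2
      ((hM.lowerSemicontinuous_T z).comp (by fun_prop) hmaps)
  · have h := lowerSemicontinuous_restrict_iff.2
      ((hM.lowerSemicontinuous_c z).comp (by fun_prop) hmaps)
    refine LowerSemicontinuous.add ?_ ?_
    · exact Continuous.lowerSemicontinuous (by fun_prop)
    · exact (continuous_const_mul t).comp_lowerSemicontinuous h fun _ _ hxy =>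
        mul_le_mul_right hxy t

theorem upperSemicontinuous_prod (hM : M.IsMonotoneModel) (p : ℕ → ℝ × ℝ≥0) (p₀ : ℝ × ℝ≥0)
    (a : ℕ → A) (hp : Tendsto p atTop (𝓝 p₀))
    (ha : ∀ k, (p k, a k) ∈ {q : (ℝ × ℝ≥0) × A | (q.1.1, q.2) ∈ M.D}) :
    ∃ a₀, (p₀, a₀) ∈ {q : (ℝ × ℝ≥0) × A | (q.1.1, q.2) ∈ M.D} ∧ MapClusterPt a₀ atTop a :=
  hM.upperSemicontinuous_D (fun k => (p k).1) p₀.1 a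
    (continuous_fst.continuousAt.tendsto.comp hp) ha

theorem exists_measurable_minimizer [TopologicalSpace.MetrizableSpace A]
    [SecondCountableTopology A] [BorelSpace A] (hM : M.IsMonotoneModel) (t : ℝ≥0)
    (hU : LowerSemicontinuous U) (hmono : Monotone U) :
    ∃ f : ℝ × ℝ≥0 → A, Measurable f ∧
      ∀ p, (p.1, f p) ∈ M.D ∧ M.costToGo t U p (f p) = M.bellman t U p := by
  obtain ⟨f, hf, h⟩ := exists_measurable_argmin (G := {q : (ℝ × ℝ≥0) × A | (q.1.1, q.2) ∈ M.D})
    (v := fun q => M.costToGo t U q.1 q.2) (fun p => hM.isCompact_D p.1)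
    (fun p => M.exists_mem_D p.1) hM.upperSemicontinuous_prod
    (hM.lowerSemicontinuousOn_costToGo t hU hmono)
  exact ⟨f, hf, fun p => ⟨(h p).1, le_antisymm (le_iInf₂ (h p).2) (M.bellman_le t U (h p).1)⟩⟩

/-- Since the infimum is attained, sublevel sets are those of `isClosed_exists_le`. -/
theorem lowerSemicontinuous_bellman [TopologicalSpace.MetrizableSpace A]
    [SecondCountableTopology A] [BorelSpace A] (hM : M.IsMonotoneModel) (t : ℝ≥0)
    (hU : LowerSemicontinuous U) (hmono : Monotone U) :
    LowerSemicontinuous (M.bellman t U) := by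
  obtain ⟨f, -, hf⟩ := hM.exists_measurable_minimizer t hU hmono
  rw [lowerSemicontinuous_iff_isClosed_preimage]
  intro r
  convert! isClosed_exists_le hM.upperSemicontinuous_prod
    (hM.lowerSemicontinuousOn_costToGo t hU hmono) isClosed_univ r using 1
  ext p
  constructor
  · exact fun h => ⟨f p, (hf p).1, trivial, (hf p).2.trans_le h⟩
  · rintro ⟨a, ha, -, h⟩
    exact (M.bellman_le t U ha).trans h

/-- An action admissible at the larger state is admissible at the smaller one, where it costs no
more. -/
theorem monotone_bellman (hM : M.IsMonotoneModel) (t : ℝ≥0) (hmono : Monotone U) :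
    Monotone (M.bellman t U) := by
  rintro ⟨x, s⟩ ⟨x', s'⟩ ⟨hx, hs⟩
  refine le_iInf₂ fun a ha => ?_
  have ha' : (x, a) ∈ M.D := hM.antitone_D x x' hx ha
  refine (M.bellman_le t U ha').trans (lintegral_mono fun z => hmono ⟨?_, ?_⟩)
  · exact hM.monotone_T x x' a z hx ha' ha
  · exact add_le_add hs (mul_le_mul_right (hM.monotone_c x x' a z hx ha' ha) t)

/-- The minimal cost operator is continuous along increasing sequences. -/
theorem bellman_iSup_le [TopologicalSpace.MetrizableSpace A] (hM : M.IsMonotoneModel) (t : ℝ≥0)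
    {U : ℕ → ℝ × ℝ≥0 → ℝ≥0∞}
    (hU : ∀ n, LowerSemicontinuous (U n)) (hmono : ∀ n, Monotone (U n)) (hinc : Monotone U) :
    M.bellman t (fun p => ⨆ n, U n p) ≤ fun p => ⨆ n, M.bellman t (U n) p := by
  intro p
  set r := ⨆ n, M.bellman t (U n) p
  have hlsc : ∀ n, LowerSemicontinuousOn (fun a => M.costToGo t (U n) p a) {a | (p.1, a) ∈ M.D} :=
    fun n => (hM.lowerSemicontinuousOn_costToGo t (hU n) (hmono n)).comp
      (g := fun a : A => (p, a)) (by fun_prop) fun a ha => ha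
  have hcomp : ∀ n, IsCompact ({a | (p.1, a) ∈ M.D} ∩ (M.costToGo t (U n) p) ⁻¹' Set.Iic r) :=
    fun n => (hlsc n).isCompact_inter_preimage_Iic (hM.isCompact_D p.1) r
  -- These nonempty compact sets decrease in `n`. A common point is one action good for every `U n`,
  -- and monotone convergence passes to the limit.
  obtain ⟨a, ha⟩ := IsCompact.nonempty_iInter_of_sequence_nonempty_isCompact_isClosed
    (fun n => {a | (p.1, a) ∈ M.D} ∩ (M.costToGo t (U n) p) ⁻¹' Set.Iic r)
    (fun n a ha => ⟨ha.1, le_trans (lintegral_mono fun z => hinc n.le_succ _) ha.2⟩)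
    (fun n => by
      obtain ⟨a, ha, hmin⟩ := (hlsc n).exists_isMinOn (M.exists_mem_D p.1) (hM.isCompact_D p.1)
      exact ⟨a, ha, le_trans (le_iInf₂ fun b hb => hmin hb)
        (le_iSup (fun n => M.bellman t (U n) p) n)⟩)
    (hcomp 0) (fun n => (hcomp n).isClosed)
  rw [Set.mem_iInter] at ha
  refine (M.bellman_le t _ (ha 0).1).trans ?_
  exact (lintegral_iSup (f := fun n z => U n (M.costStep t p a z))
    (fun n => (hU n).measurable.comp (M.measurable_costStep t (ha 0).1))
    fun m n hmn z => hinc hmn _).trans_le (iSup_le fun n => (ha n).2)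

end IsMonotoneModel

section Convexity

variable {V : Type*} [AddCommGroup V] [Module ℝ V] {A : Set V} [MeasurableSpace A]
  {M : StationaryMDP ℝ A 𝒵 P} {U : ℝ × ℝ≥0 → ℝ≥0∞}

theorem convexOn_bellman (hD : ConvexPairs M.D)
    (hT : ∀ z, ConvexFunOnPairs M.D fun p => M.T p.1 p.2 z)
    (hc : ∀ z, ConvexFunOnPairs M.D fun p => (M.c p.1 p.2 (M.T p.1 p.2 z) : ℝ))
    (t : ℝ≥0) (hmin : ∀ p : ℝ × ℝ≥0, ∃ a, (p.1, a) ∈ M.D ∧ M.costToGo t U p a = M.bellman t U p)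
    (hmeas : Measurable U) (hmono : Monotone U) (hU : ConvexOn ℝ≥0 Set.univ U) :
    ConvexOn ℝ≥0 Set.univ (M.bellman t U) := by
  refine ⟨convex_univ, fun p _ q _ α γ _ _ hsum => ?_⟩
  have hsum' : (α : ℝ) + γ = 1 := by exact_mod_cast hsum
  simp only [ENNReal.smul_def, smul_eq_mul]
  have key : ∀ a, (p.1, a) ∈ M.D → ∀ b, (q.1, b) ∈ M.D →
      M.bellman t U (α • p + γ • q) ≤ α * M.costToGo t U p a + γ * M.costToGo t U q b := by
    intro a ha b hb
    -- Convexity of `D` ensures that the combined vector is an element `e` of `A`, admissible at the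
    -- combined state.
    obtain ⟨⟨x, e⟩, he, heq⟩ := hD ⟨_, ha, rfl⟩ ⟨_, hb, rfl⟩ α.2 γ.2 hsum'
    simp only [Prod.ext_iff, Prod.fst_add, Prod.snd_add, Prod.smul_fst, Prod.smul_snd] at heq
    obtain ⟨hx, hev⟩ := heq
    have hx' : x = (α • p + γ • q).1 := hx
    subst hx'
    have hTle := fun z => hT z _ ha _ hb _ he α γ α.2 γ.2 hsum' hx hev
    have hcle := fun z => hc z _ ha _ hb _ he α γ α.2 γ.2 hsum' hx hev
    refine (M.bellman_le t U he).trans ?_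
    have hmp : Measurable fun z => U (M.costStep t p a z) :=
      hmeas.comp (M.measurable_costStep t ha)
    have hmq : Measurable fun z => U (M.costStep t q b z) :=
      hmeas.comp (M.measurable_costStep t hb)
    unfold costToGo
    rw [← lintegral_const_mul _ hmp, ← lintegral_const_mul _ hmq,
      ← lintegral_add_left (hmp.const_mul _)]
    refine lintegral_mono fun z => ?_
    refine le_trans (hmono (b := α • M.costStep t p a z + γ • M.costStep t q b z) ⟨?_, ?_⟩)
      (hU.2 trivial trivial zero_le zero_le hsum)
    · exact hTle z
    · have h := hcle z
      change (α • p + γ • q).2 + t * M.c _ e (M.T _ e z) ≤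
        α * (p.2 + t * M.c p.1 a (M.T p.1 a z)) + γ * (q.2 + t * M.c q.1 b (M.T q.1 b z))
      have h' : M.c (α • p + γ • q).1 e (M.T (α • p + γ • q).1 e z) ≤
          α * M.c p.1 a (M.T p.1 a z) + γ * M.c q.1 b (M.T q.1 b z) := by exact_mod_cast h
      calc (α • p + γ • q).2 + t * M.c _ e (M.T _ e z)
          ≤ (α * p.2 + γ * q.2) +
            t * (α * M.c p.1 a (M.T p.1 a z) + γ * M.c q.1 b (M.T q.1 b z)) :=
            add_le_add le_rfl (mul_le_mul_right h' t)
        _ = _ := by ring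
  obtain ⟨a, ha, hpa⟩ := hmin p
  obtain ⟨b, hb, hqb⟩ := hmin q
  rw [← hpa, ← hqb]
  exact key a ha b hb

end Convexity

end StationaryMDP

/-! ### The controlled process and its Markov property. -/

namespace StationaryMDP

section ExtendedDynamics

variable {E A 𝒵 Ω : Type*} [MeasurableSpace E] [MeasurableSpace A] [MeasurableSpace 𝒵]
  [mΩ : MeasurableSpace Ω] {P : Measure Ω} (M : StationaryMDP E A 𝒵 P) (π : M.MarkovPolicy)
  (y : ExtState E)

/-- The state and the accumulated cost of the extended decision process. -/
def stateCost (n : ℕ) (ω : Ω) : E × ℝ≥0 :=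
  ((M.process π y n ω).1, (M.process π y n ω).2.1)

theorem process_discount (n : ℕ) (ω : Ω) :
    ((M.process π y n ω).2.2 : ℝ≥0) = M.β ^ n * y.2.2 := by
  induction n with
  | zero => simp [process]
  | succ n ih =>
    change M.β * ((M.process π y n ω).2.2 : ℝ≥0) = _
    rw [ih]
    ring

theorem stateCost_succ (n : ℕ) (ω : Ω) :
    M.stateCost π y (n + 1) ω =
      M.costStep (M.β ^ n * y.2.2) (M.stateCost π y n ω) (π.d n (M.process π y n ω)) (M.Z n ω) := by
  rw [← M.process_discount π y n ω]
  rfl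

theorem stateCost_snd (n : ℕ) (ω : Ω) :
    (M.stateCost π y n ω).2 =
      y.2.1 + (y.2.2 : ℝ≥0) * ∑ k ∈ Finset.range n, M.β ^ k * M.stageCost π y k ω := by
  induction n with
  | zero => simp [stateCost, process]
  | succ n ih =>
    rw [stateCost_succ, Finset.sum_range_succ, mul_add, ← add_assoc, ← ih]
    change _ + _ * M.stageCost π y n ω = _
    ring

theorem measurable_extT_comp {Y : Type*} [MeasurableSpace Y] {v : Y → ExtState E} {a : Y → A}
    {z : Y → 𝒵} (hv : Measurable v) (ha : Measurable a) (hz : Measurable z)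
    (hD : ∀ w, ((v w).1, a w) ∈ M.D) : Measurable fun w => M.extT (v w) (a w) (z w) := by
  have hT := M.measurable_T_comp hv.fst ha hz hD
  have ht : Measurable fun w => ((v w).2.2 : ℝ≥0) := measurable_subtype_coe.comp hv.snd.snd
  refine hT.prodMk ((hv.snd.fst.add (ht.mul (M.measurable_c_comp hv.fst ha hT hD))).prodMk ?_)
  exact (ht.const_mul M.β).subtype_mk

/-- The state at time `n` depends only on `Z 0, …, Z (n - 1)`, which makes it independent of `Z n`.
-/
theorem measurable_process_past (n : ℕ) :
    Measurable[⨆ i ∈ Set.Iio n, MeasurableSpace.comap (M.Z i) inferInstance]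
      (M.process π y n) := by
  induction n with
  | zero => exact measurable_const
  | succ n ih =>
    have hle : (⨆ i ∈ Set.Iio n, MeasurableSpace.comap (M.Z i) inferInstance) ≤
        ⨆ i ∈ Set.Iio (n + 1), MeasurableSpace.comap (M.Z i) inferInstance :=
      biSup_mono fun i hi => hi.trans n.lt_succ_self
    have hp := ih.mono hle le_rfl
    have hz : Measurable[⨆ i ∈ Set.Iio (n + 1), MeasurableSpace.comap (M.Z i) inferInstance]
        (M.Z n) :=
      (comap_measurable (M.Z n)).mono
        (le_iSup₂ (f := fun i (_ : i ∈ Set.Iio (n + 1)) =>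
          MeasurableSpace.comap (M.Z i) inferInstance) n n.lt_succ_self) le_rfl
    exact @measurable_extT_comp _ _ _ _ _ _ _ _ _ M Ω
      (⨆ i ∈ Set.Iio (n + 1), MeasurableSpace.comap (M.Z i) inferInstance) _ _ _ hp
      ((π.measurable_d n).comp hp) hz fun ω => π.admissible n _

theorem measurable_process (n : ℕ) : Measurable (M.process π y n) :=
  (M.measurable_process_past π y n).mono (iSup₂_le fun i _ => (M.measurable_Z i).comap_le) le_rfl

theorem measurable_stateCost (n : ℕ) : Measurable (M.stateCost π y n) :=
  (M.measurable_process π y n).fst.prodMk (M.measurable_process π y n).snd.fst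

theorem indepFun_process (n : ℕ) : IndepFun (M.process π y n) (M.Z n) P := by
  have h := indep_iSup_of_disjoint (fun i => (M.measurable_Z i).comap_le)
    ((iIndepFun_iff_iIndep _ _ _).1 M.indep_Z) (S := Set.Iio n) (T := {n}) (by simp)
  rw [IndepFun_iff_Indep]
  exact indep_of_indep_of_le_left (indep_of_indep_of_le_right h (by simp))
    (M.measurable_process_past π y n).comap_le

/-- The Markov property: independence splits the joint law, Tonelli integrates out `Z n`, and
equality in law replaces it by `Z 0`. -/
theorem lintegral_stateCost_succ [IsFiniteMeasure P] {U : E × ℝ≥0 → ℝ≥0∞} (hU : Measurable U)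
    (n : ℕ) :
    ∫⁻ ω, U (M.stateCost π y (n + 1) ω) ∂P =
      ∫⁻ ω, M.costToGo (M.β ^ n * y.2.2) U (M.stateCost π y n ω)
        (π.d n (M.process π y n ω)) ∂P := by
  set t : ℝ≥0 := M.β ^ n * y.2.2
  set F : ExtState E × 𝒵 → ℝ≥0∞ := fun q =>
    U (M.costStep t (q.1.1, q.1.2.1) (π.d n q.1) q.2)
  have hF : Measurable F := hU.comp (M.measurable_costStep_comp t (by fun_prop)
    ((π.measurable_d n).comp measurable_fst) measurable_snd fun q => π.admissible n q.1)
  have hpr := M.measurable_process π y n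
  have hZ := M.measurable_Z n
  have hmap := (indepFun_iff_map_prod_eq_prod_map_map hpr.aemeasurable hZ.aemeasurable).1
    (M.indepFun_process π y n)
  calc ∫⁻ ω, U (M.stateCost π y (n + 1) ω) ∂P
      = ∫⁻ ω, F (M.process π y n ω, M.Z n ω) ∂P := by
        simp only [stateCost_succ]; rfl
    _ = ∫⁻ q, F q ∂(P.map fun ω => (M.process π y n ω, M.Z n ω)) :=
        (lintegral_map hF (hpr.prodMk hZ)).symm
    _ = ∫⁻ v, ∫⁻ z, F (v, z) ∂(P.map (M.Z n)) ∂(P.map (M.process π y n)) := by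
        rw [hmap, lintegral_prod _ hF.aemeasurable]
    _ = ∫⁻ ω, ∫⁻ z, F (M.process π y n ω, z) ∂(P.map (M.Z n)) ∂P :=
        lintegral_map hF.lintegral_prod_right' hpr
    _ = _ := by rw [(M.identDistrib_Z n).map_eq]; rfl

/-- If `V k` is dominated by the minimal cost operator applied to `V (k + 1)`, then its
expectation along the process is nondecreasing. -/
theorem le_lintegral_stateCost [IsProbabilityMeasure P] {V : ℕ → E × ℝ≥0 → ℝ≥0∞} (n : ℕ)
    (hmeas : ∀ k, Measurable (V k))
    (hV : ∀ k < n, V k ≤ M.bellman (M.β ^ k * y.2.2) (V (k + 1))) :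
    V 0 (y.1, y.2.1) ≤ ∫⁻ ω, V n (M.stateCost π y n ω) ∂P := by
  induction n with
  | zero => simp [stateCost, process]
  | succ n ih =>
    refine (ih fun k hk => hV k (hk.trans n.lt_succ_self)).trans ?_
    rw [M.lintegral_stateCost_succ π y (hmeas (n + 1))]
    exact lintegral_mono fun ω => (hV n n.lt_succ_self _).trans
      (M.bellman_le _ _ (π.admissible n _))

end ExtendedDynamics

/-! ### Backward induction and accumulated costs. -/

section Values

variable {E A 𝒵 Ω : Type*} [MeasurableSpace E] [MeasurableSpace A] [MeasurableSpace 𝒵]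
  [MeasurableSpace Ω] {P : Measure Ω} {M : StationaryMDP E A 𝒵 P} {g : ℝ → ℝ}

/-- The values of the backward induction for the planning horizon `n` at discount level `t`. -/
noncomputable def backwardValue (M : StationaryMDP E A 𝒵 P) (g : ℝ → ℝ) :
    ℕ → ℝ≥0 → E × ℝ≥0 → ℝ≥0∞
  | 0, _ => fun p => ENNReal.ofReal (g p.2)
  | n + 1, t => M.bellman t (backwardValue M g n (M.β * t))

/-- One stage can only raise the accumulated cost; the monotone operator propagates this first
inequality. -/
theorem monotone_backwardValue_horizon [IsProbabilityMeasure P] (hg : Monotone g) (t : ℝ≥0) :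
    Monotone fun n => M.backwardValue g n t := by
  refine monotone_nat_of_le_succ fun n => ?_
  induction n generalizing t with
  | zero =>
    intro p
    refine le_iInf₂ fun a ha => ?_
    have : IsProbabilityMeasure (P.map (M.Z 0)) :=
      Measure.isProbabilityMeasure_map (M.measurable_Z 0).aemeasurable
    calc ENNReal.ofReal (g p.2) = ∫⁻ _, ENNReal.ofReal (g p.2) ∂(P.map (M.Z 0)) := by simp
      _ ≤ _ := lintegral_mono fun z =>
        ENNReal.ofReal_le_ofReal (hg (NNReal.coe_le_coe.2 le_self_add))
  | succ n ih => exact M.bellman_mono t (ih _)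

theorem policyValue_eq_lintegral_stateCost (n : ℕ) (π : M.MarkovPolicy) (y : ExtState E) :
    M.policyValue g n π y = ∫⁻ ω, ENNReal.ofReal (g (M.stateCost π y n ω).2) ∂P := by
  simp only [policyValue, stateCost_snd]

/-- At time `k`, `n - k` stages remain and the discount level is `β ^ k * t`. -/
theorem backwardValue_sub_succ {n k : ℕ} (hk : k < n) (t : ℝ≥0) :
    M.backwardValue g (n - k) (M.β ^ k * t) =
      M.bellman (M.β ^ k * t) (M.backwardValue g (n - (k + 1)) (M.β ^ (k + 1) * t)) := by
  obtain ⟨m, rfl⟩ : ∃ m, n = m + (k + 1) := ⟨n - (k + 1), by omega⟩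
  rw [Nat.add_sub_cancel, show m + (k + 1) - k = m + 1 by omega, backwardValue,
    ← mul_assoc, ← pow_succ']

theorem extendTop_mono (hg : Monotone g) {u : ℝ≥0} {v : ℝ≥0∞} (h : (u : ℝ≥0∞) ≤ v) :
    ENNReal.ofReal (g u) ≤ extendTop g v := by
  unfold extendTop
  split_ifs with hv
  · exact le_iSup (fun r : ℝ≥0 => ENNReal.ofReal (g r)) u
  · exact ENNReal.ofReal_le_ofReal (hg ((ENNReal.toReal_mono hv h)))

theorem extendTop_iSup_le (hg : Monotone g) (hcont : Continuous g) {u : ℕ → ℝ≥0}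
    (hu : Monotone u) :
    extendTop g (⨆ n, (u n : ℝ≥0∞)) ≤ ⨆ n, ENNReal.ofReal (g (u n)) := by
  have hlim : Tendsto (fun n => (u n : ℝ≥0∞)) atTop (𝓝 (⨆ n, (u n : ℝ≥0∞))) :=
    tendsto_atTop_iSup fun m n h => ENNReal.coe_le_coe.2 (hu h)
  unfold extendTop
  split_ifs with hv
  · refine iSup_le fun r => ?_
    rw [hv] at hlim
    obtain ⟨n, hn⟩ := (hlim.eventually (lt_mem_nhds (ENNReal.coe_lt_top (r := r)))).exists
    exact le_iSup_of_le n (ENNReal.ofReal_le_ofReal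
      (hg (NNReal.coe_le_coe.2 (ENNReal.coe_le_coe.1 hn.le))))
  · have h1 : Tendsto (fun n => (u n : ℝ)) atTop (𝓝 (⨆ n, (u n : ℝ≥0∞)).toReal) :=
      (ENNReal.tendsto_toReal hv).comp hlim
    exact le_of_tendsto' ((ENNReal.continuous_ofReal.comp hcont).continuousAt.tendsto.comp h1)
      fun n => le_iSup (fun n => ENNReal.ofReal (g (u n))) n

theorem monotone_stateCost_snd (π : M.MarkovPolicy) (y : ExtState E) (ω : Ω) :
    Monotone fun n => (M.stateCost π y n ω).2 := by
  refine monotone_nat_of_le_succ fun n => ?_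
  rw [stateCost_succ]
  exact le_self_add

theorem iSup_stateCost_snd (π : M.MarkovPolicy) (y : ExtState E) (ω : Ω) :
    ⨆ n, ((M.stateCost π y n ω).2 : ℝ≥0∞) =
      (y.2.1 : ℝ≥0∞) + ((y.2.2 : ℝ≥0) : ℝ≥0∞) *
        ∑' k : ℕ, ((M.β ^ k * M.stageCost π y k ω : ℝ≥0) : ℝ≥0∞) := by
  rw [ENNReal.tsum_eq_iSup_nat, ENNReal.mul_iSup, ENNReal.add_iSup]
  refine iSup_congr fun n => ?_
  rw [stateCost_snd]
  push_cast
  rfl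

theorem IsMonotoneModel.monotone_backwardValue {A : Type*} [TopologicalSpace A]
    [MeasurableSpace A] {M : StationaryMDP ℝ A 𝒵 P} (hM : M.IsMonotoneModel) (hg : Monotone g)
    (n : ℕ) (t : ℝ≥0) : Monotone (M.backwardValue g n t) := by
  induction n generalizing t with
  | zero => exact fun p q h => ENNReal.ofReal_le_ofReal (hg (NNReal.coe_le_coe.2 h.2))
  | succ n ih => exact hM.monotone_bellman t (ih _)

end Values

/-! ### Optimal policies and identification of the value functions. -/

section Optimality

variable {A 𝒵 Ω : Type*} [TopologicalSpace A] [TopologicalSpace.MetrizableSpace A]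
  [SecondCountableTopology A] [MeasurableSpace A] [BorelSpace A] [MeasurableSpace 𝒵]
  [MeasurableSpace Ω] {P : Measure Ω} {M : StationaryMDP ℝ A 𝒵 P}

/-- Rule `k` minimizes the expected `V (k + 1)` at level `β ^ k * t`. The policy depends on neither
the initial `(x, s)` nor `n`, so it also serves the infinite horizon. -/
theorem IsMonotoneModel.exists_policy [IsProbabilityMeasure P] (hM : M.IsMonotoneModel)
    (t : ℝ≥0) {V : ℕ → ℝ × ℝ≥0 → ℝ≥0∞} (hlsc : ∀ k, LowerSemicontinuous (V k))
    (hmono : ∀ k, Monotone (V k)) :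
    ∃ π : M.MarkovPolicy, ∀ (y : ExtState ℝ) (n : ℕ), (y.2.2 : ℝ≥0) = t →
      (∀ k < n, M.bellman (M.β ^ k * t) (V (k + 1)) ≤ V k) →
      ∫⁻ ω, V n (M.stateCost π y n ω) ∂P ≤ V 0 (y.1, y.2.1) := by
  choose f hf hfmin using fun k =>
    hM.exists_measurable_minimizer (M.β ^ k * t) (hlsc (k + 1)) (hmono (k + 1))
  refine ⟨⟨fun k y => f k (y.1, y.2.1), fun k => (hf k).comp (by fun_prop),
    fun k y => (hfmin k (y.1, y.2.1)).1⟩, fun y n hy hV => ?_⟩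
  subst hy
  induction n with
  | zero => simp [stateCost, process]
  | succ n ih =>
    refine le_trans ?_ (ih fun k hk => hV k (hk.trans n.lt_succ_self))
    rw [M.lintegral_stateCost_succ _ y (hlsc (n + 1)).measurable]
    exact lintegral_mono fun ω => (hfmin n _).2.trans_le (hV n n.lt_succ_self _)

variable {g : ℝ → ℝ}

theorem IsMonotoneModel.lowerSemicontinuous_backwardValue (hM : M.IsMonotoneModel)
    (hg : Monotone g) (hcont : Continuous g) (n : ℕ) (t : ℝ≥0) :
    LowerSemicontinuous (M.backwardValue g n t) := by
  induction n generalizing t with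
  | zero =>
    have : Continuous fun p : ℝ × ℝ≥0 => g p.2 := by fun_prop
    exact (ENNReal.continuous_ofReal.comp this).lowerSemicontinuous
  | succ n ih => exact hM.lowerSemicontinuous_bellman t (ih _) (hM.monotone_backwardValue hg n _)

theorem IsMonotoneModel.value_eq_backwardValue [IsProbabilityMeasure P]
    (hM : M.IsMonotoneModel) (hg : Monotone g) (hcont : Continuous g) (n : ℕ) (y : ExtState ℝ) :
    M.value g n y = M.backwardValue g n y.2.2 (y.1, y.2.1) := by
  -- Past the horizon `n - k` truncates to `0`; this is harmless, since the recursion is only needed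
  -- for `k < n`.
  have hlsc : ∀ k, LowerSemicontinuous (M.backwardValue g (n - k) (M.β ^ k * y.2.2)) :=
    fun k => hM.lowerSemicontinuous_backwardValue hg hcont _ _
  apply le_antisymm
  · obtain ⟨π, hπ⟩ := hM.exists_policy y.2.2 hlsc fun k => hM.monotone_backwardValue hg _ _
    have h := hπ y n rfl fun k hk => (backwardValue_sub_succ hk _).ge
    refine (iInf_le _ π).trans ?_
    rw [policyValue_eq_lintegral_stateCost]
    simpa [backwardValue] using h
  · refine le_iInf fun π => ?_
    have h := M.le_lintegral_stateCost π y n (fun k => (hlsc k).measurable)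
      fun k hk => (backwardValue_sub_succ hk _).le
    rw [policyValue_eq_lintegral_stateCost]
    simpa [backwardValue] using h

theorem IsMonotoneModel.valueInfty_eq_iSup [IsProbabilityMeasure P]
    (hM : M.IsMonotoneModel) (hg : Monotone g) (hcont : Continuous g) (y : ExtState ℝ) :
    M.valueInfty g y = ⨆ n, M.backwardValue g n y.2.2 (y.1, y.2.1) := by
  apply le_antisymm
  · have hlsc := fun n t => hM.lowerSemicontinuous_backwardValue hg hcont n t
    have hmono := fun n t => hM.monotone_backwardValue hg n t
    obtain ⟨π, hπ⟩ := hM.exists_policy y.2.2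
      (V := fun k p => ⨆ n, M.backwardValue g n (M.β ^ k * y.2.2) p)
      (fun k => lowerSemicontinuous_iSup fun n => hlsc n _)
      (fun k p q h => iSup_mono fun n => hmono n _ h)
    have hbellman : ∀ k, M.bellman (M.β ^ k * y.2.2)
        (fun p => ⨆ n, M.backwardValue g n (M.β ^ (k + 1) * y.2.2) p) ≤
          fun p => ⨆ n, M.backwardValue g n (M.β ^ k * y.2.2) p := by
      intro k
      refine (hM.bellman_iSup_le _ (fun n => hlsc n _) (fun n => hmono n _)
        (monotone_backwardValue_horizon hg _)).trans fun p => iSup_le fun n => ?_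
      refine le_iSup_of_le (n + 1) (le_of_eq ?_)
      rw [backwardValue, ← mul_assoc, ← pow_succ']
    refine (iInf_le _ π).trans ?_
    calc M.policyValueInfty g π y
        ≤ ∫⁻ ω, ⨆ n, ENNReal.ofReal (g (M.stateCost π y n ω).2) ∂P := by
          refine lintegral_mono fun ω => ?_
          rw [← iSup_stateCost_snd]
          exact extendTop_iSup_le hg hcont (monotone_stateCost_snd π y ω)
      _ = ⨆ n, ∫⁻ ω, ENNReal.ofReal (g (M.stateCost π y n ω).2) ∂P :=
          lintegral_iSup
            (fun n => ENNReal.measurable_ofReal.comp (hcont.measurable.comp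
              (measurable_coe_nnreal_real.comp (M.measurable_stateCost π y n).snd)))
            fun m n h ω => ENNReal.ofReal_le_ofReal
              (hg (NNReal.coe_le_coe.2 (monotone_stateCost_snd π y ω h)))
      _ ≤ _ := iSup_le fun n => by
          refine le_trans (lintegral_mono fun ω => ?_)
            ((hπ y n rfl fun k _ => hbellman k).trans (by simp))
          -- The horizon-zero term of the supremum is `g` of the cost accumulated so far.
          exact le_iSup (fun n => M.backwardValue g n _ (M.stateCost π y _ ω)) 0
  -- Conversely, truncating the cost of any policy at stage `n` can only lower it.
  · refine le_iInf fun π => iSup_le fun n => ?_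
    rw [← hM.value_eq_backwardValue hg hcont]
    refine (iInf_le _ π).trans ?_
    rw [policyValue_eq_lintegral_stateCost]
    refine lintegral_mono fun ω => extendTop_mono hg ?_
    rw [← iSup_stateCost_snd]
    exact le_iSup (fun n => ((M.stateCost π y n ω).2 : ℝ≥0∞)) n

end Optimality

/-! ### Convexity of the value functions. -/

theorem IsMonotoneModel.convexOn_backwardValue {V : Type*} [AddCommGroup V] [Module ℝ V]
    {A : Set V} [TopologicalSpace A] [TopologicalSpace.MetrizableSpace A]
    [SecondCountableTopology A] [MeasurableSpace A] [BorelSpace A] {𝒵 Ω : Type*}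
    [MeasurableSpace 𝒵] [MeasurableSpace Ω] {P : Measure Ω}
    {M : StationaryMDP ℝ A 𝒵 P} {g : ℝ → ℝ} (hM : M.IsMonotoneModel) (hg : Monotone g)
    (hcont : Continuous g) (hconv : ConvexOn ℝ Set.univ g) (hnonneg : ∀ r, 0 ≤ r → 0 ≤ g r)
    (hD : ConvexPairs M.D)
    (hT : ∀ z, ConvexFunOnPairs M.D fun p => M.T p.1 p.2 z)
    (hc : ∀ z, ConvexFunOnPairs M.D fun p => (M.c p.1 p.2 (M.T p.1 p.2 z) : ℝ)) (n : ℕ)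
    (t : ℝ≥0) : ConvexOn ℝ≥0 Set.univ (M.backwardValue g n t) := by
  induction n generalizing t with
  | zero =>
    refine ⟨convex_univ, fun p _ q _ α γ _ _ hsum => ?_⟩
    have hsum' : (α : ℝ) + γ = 1 := by exact_mod_cast hsum
    have h := hconv.2 (x := (p.2 : ℝ)) trivial (y := (q.2 : ℝ)) trivial α.2 γ.2 hsum'
    calc ENNReal.ofReal (g (α • p + γ • q).2)
        = ENNReal.ofReal (g ((α : ℝ) • (p.2 : ℝ) + (γ : ℝ) • (q.2 : ℝ))) := by simp
      _ ≤ ENNReal.ofReal ((α : ℝ) • g p.2 + (γ : ℝ) • g q.2) := ENNReal.ofReal_le_ofReal h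
      _ = α • ENNReal.ofReal (g p.2) + γ • ENNReal.ofReal (g q.2) := by
        -- Nonnegativity of `g` on `[0, ∞)` is what makes `ENNReal.ofReal` additive here.
        have hp := hnonneg p.2 p.2.2
        have hq := hnonneg q.2 q.2.2
        simp only [ENNReal.smul_def, smul_eq_mul]
        rw [ENNReal.ofReal_add (mul_nonneg α.coe_nonneg hp) (mul_nonneg γ.coe_nonneg hq),
          ENNReal.ofReal_mul α.coe_nonneg, ENNReal.ofReal_mul γ.coe_nonneg,
          ENNReal.ofReal_coe_nnreal, ENNReal.ofReal_coe_nnreal]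
  | succ n ih =>
    have hlsc := hM.lowerSemicontinuous_backwardValue hg hcont n (M.β * t)
    have hmono := hM.monotone_backwardValue hg n (M.β * t)
    obtain ⟨f, -, hf⟩ := hM.exists_measurable_minimizer t hlsc hmono
    exact convexOn_bellman hD hT hc t (fun p => ⟨f p, hf p⟩) hlsc.measurable hmono (ih _)

end StationaryMDP

theorem convexOn_iSup_ennreal {X ι : Type*} [AddCommMonoid X] [Module ℝ≥0 X]
    {f : ι → X → ℝ≥0∞} (hf : ∀ i, ConvexOn ℝ≥0 Set.univ (f i)) :
    ConvexOn ℝ≥0 Set.univ fun x => ⨆ i, f i x := by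
  refine ⟨convex_univ, fun p _ q _ α γ hα hγ hsum => iSup_le fun i => ?_⟩
  refine ((hf i).2 trivial trivial hα hγ hsum).trans (add_le_add ?_ ?_)
  · simp only [ENNReal.smul_def, smul_eq_mul]
    gcongr
    exact le_iSup (fun i => f i p) i
  · simp only [ENNReal.smul_def, smul_eq_mul]
    gcongr
    exact le_iSup (fun i => f i q) i

/-- The action space is a Borel space (a separable metrizable space whose Borel σ-algebra is
standard) that is a subset of a real vector space. The value functions have values in `[0, ∞]`;
their convexity in `(x, s) ∈ ℝ × [0, ∞)` is expressed with weights in `[0, ∞)` of sum one. -/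
theorem lemma6p3 {V : Type*} [AddCommGroup V] [Module ℝ V] {A : Set V}
    [TopologicalSpace A] [TopologicalSpace.MetrizableSpace A] [SecondCountableTopology A]
    [MeasurableSpace A] [BorelSpace A] [StandardBorelSpace A]
    {𝒵 : Type*} [MeasurableSpace 𝒵]
    {Ω : Type*} [MeasurableSpace Ω] {P : Measure Ω} [IsProbabilityMeasure P]
    (M : StationaryMDP ℝ A 𝒵 P)
    (g : ℝ → ℝ) (hg_mono : Monotone g) (hg_conv : ConvexOn ℝ Set.univ g)
    (hg_nonneg : ∀ r, 0 ≤ r → 0 ≤ g r)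
    (hM : M.IsMonotoneModel)
    (hD : ConvexPairs M.D)
    (hT : ∀ z, ConvexFunOnPairs M.D fun p => M.T p.1 p.2 z)
    (hc : ∀ z, ConvexFunOnPairs M.D fun p => (M.c p.1 p.2 (M.T p.1 p.2 z) : ℝ))
    (t : Set.Ioi (0 : ℝ≥0)) :
    (∀ n : ℕ, ConvexOn ℝ≥0 Set.univ fun p : ℝ × ℝ≥0 => M.value g n (p.1, p.2, t)) ∧
      ConvexOn ℝ≥0 Set.univ fun p : ℝ × ℝ≥0 => M.valueInfty g (p.1, p.2, t) := by
  have hcont : Continuous g := by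
    rw [← continuousOn_univ]
    exact hg_conv.continuousOn isOpen_univ
  have hconv := fun n => hM.convexOn_backwardValue hg_mono hcont hg_conv hg_nonneg hD hT hc n t
  refine ⟨fun n => ?_, ?_⟩
  · simp only [hM.value_eq_backwardValue hg_mono hcont]
    exact hconv n
  · simp only [hM.valueInfty_eq_iSup hg_mono hcont]
    exact convexOn_iSup_ennreal hconv
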